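/- Let $\mathbb{F}_q$ be a finite field with $q$ elements, let $\theta$ and $t$ be independent variables, $k=\mathbb{F}_q(\theta)$, and let $L/k$ be a finite field extension. For a place $v$ of $L$ let $\mathrm{ord}_v$ be the additive valuation of $v$, normalized so that a uniformizer has order $1$; for a polynomial $h\in L[t]$ let $\mathrm{ord}_v(h)$ be the minimum of the orders of its coefficients. Let $L[\tau]$ be the twisted polynomial ring with $\tau\alpha=\alpha^q\tau$ for $\alpha\in L$, where $\tau$ acts on $L$ by $x\mapsto x^q$. Let $E$ be a Drinfeld $\mathbb{F}_q[t]$-module over $L$, i.e. an $\mathbb{F}_q$-algebra homomorphism $\phi:\mathbb{F}_q[t]\to L[\tau]$, $a\mapsto\phi_a$, whose image is not contained in $L$, with $\phi_t=\theta+\kappa_1\tau+\cdots+\kappa_r\tau^r$, $\kappa_r\neq 0$. Let $E(L)$ be the additive group of $L$ with the $\mathbb{F}_q[t]$-module structure in which $a$ acts by $\phi_a$. For each place $v$ let $\mathcal{S}_v$ be the slope of the rightmost edge of the Newton polygon at $v$ (lower convex hull) of $(t-\theta)x+\kappa_1x^q+\cdots+\kappa_rx^{q^r}\in L[t][x]$,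 that is, of the points $(1,\mathrm{ord}_v(t-\theta))$ and $(q^j,\mathrm{ord}_v(\kappa_j))$ for $1\le j\le r$ with $\kappa_j\ne 0$; put $\mathrm{div}(E_{\mathrm{slope}})=\sum_v\lceil\mathcal{S}_v\rceil\cdot v$. Let $P_1,\dots,P_\ell\in E(L)$ be distinct non-zero points, let $\mathrm{div}(P_1,\dots,P_\ell)=\sum_v\min_i\mathrm{ord}_v(P_i)\cdot v$, and let $$D=\bigl(-\mathrm{div}(P_1,\dots,P_\ell)\bigr)\vee\mathrm{div}(E_{\mathrm{slope}}),$$ where $\vee$ denotes the coefficientwise maximum of two divisors. Then the Riemann-Roch space $\mathcal{L}(D)=\{f\in L:\mathrm{ord}_v(f)\ge -D(v)\text{ for all places }v\}$, where $\mathrm{ord}_v(0)=\infty$, is finite-dimensional over $\mathbb{F}_q$. Let $d$ be its dimension. If $$\sum_{i=1}^\ell\phi_{a_i}(P_i)\neq 0$$ for all $(a_1,\dots,a_\ell)\in\mathbb{F}_q[t]^\ell$, not all $a_i$ zero, with $\deg_t(a_i)\le d+\ell$ for all $i$, then $P_1,\dots,P_\ell$ are $\mathbb{F}_q[t]$-linearly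 independent in $E(L)$. -/

import Mathlib

open Polynomial

noncomputable section

namespace Drinfeld

section TwistedPolynomial

/-! ### Twisted polynomials -/

/-- A copy of `L`, on which `ℕ` acts by iterating the `q`-th power map `x ↦ x ^ q`, `q = #F`. -/
@[nolint unusedArguments]
def FrobScalars (_F L : Type*) : Type _ := L

variable (F L : Type*) [Field F] [Fintype F] [Field L] [Algebra F L]

instance : Field (FrobScalars F L) := inferInstanceAs (Field L)

instance : Algebra F (FrobScalars F L) := inferInstanceAs (Algebra F L)

variable {L} in
theorem frobenius_iterate (n : ℕ) (x : L) :
    ((FiniteField.frobeniusAlgHom F L) ^ n) x = x ^ Fintype.card F ^ n := by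
  rw [AlgHom.coe_pow, FiniteField.coe_frobeniusAlgHom, pow_iterate]

instance : MulSemiringAction (Multiplicative ℕ) (FrobScalars F L) where
  smul n x := x ^ Fintype.card F ^ n.toAdd
  one_smul x := by
    change x ^ Fintype.card F ^ 0 = x
    simp
  mul_smul m n x := by
    change x ^ Fintype.card F ^ (m.toAdd + n.toAdd)
      = (x ^ Fintype.card F ^ n.toAdd) ^ Fintype.card F ^ m.toAdd
    rw [← pow_mul, ← pow_add, add_comm]
  smul_zero n := by
    change (0 : FrobScalars F L) ^ Fintype.card F ^ n.toAdd = 0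
    rw [← frobenius_iterate, map_zero]
  smul_add n x y := by
    change (x + y) ^ Fintype.card F ^ n.toAdd
      = x ^ Fintype.card F ^ n.toAdd + y ^ Fintype.card F ^ n.toAdd
    simp only [← frobenius_iterate, map_add]
  smul_one n := by
    change (1 : FrobScalars F L) ^ Fintype.card F ^ n.toAdd = 1
    rw [one_pow]
  smul_mul n x y := by
    change (x * y) ^ Fintype.card F ^ n.toAdd
      = x ^ Fintype.card F ^ n.toAdd * y ^ Fintype.card F ^ n.toAdd
    rw [mul_pow]

variable {F L} in
theorem FrobScalars.smul_def (n : Multiplicative ℕ) (x : FrobScalars F L) :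
    n • x = x ^ Fintype.card F ^ n.toAdd := rfl

instance : SMulCommClass (Multiplicative ℕ) F (FrobScalars F L) where
  smul_comm n c x := by
    simp only [FrobScalars.smul_def, ← frobenius_iterate, map_smul]

/-- The twisted polynomial ring `L[τ]`, subject to `τ * c = c ^ q * τ` for `c : L`, `q = #F`. -/
abbrev TwistedPolynomial : Type _ := SkewPolynomial (FrobScalars F L)

variable {F L}

namespace TwistedPolynomial

/-- The coefficient of `τ ^ i`. -/
def coeff (u : TwistedPolynomial F L) (i : ℕ) : L := SkewPolynomial.coeff u i

variable (F) in
/-- The constant twisted polynomial `c`. -/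
def const (c : L) : TwistedPolynomial F L := SkewPolynomial.C (R := FrobScalars F L) c

/-- The variable `τ`. -/
def tau : TwistedPolynomial F L := SkewPolynomial.X

theorem tau_mul_const (c : L) :
    tau * const F c = const F (c ^ Fintype.card F) * tau := by
  have h : ∀ c : FrobScalars F L, (SkewPolynomial.X * SkewPolynomial.C c :
      SkewPolynomial (FrobScalars F L)) =
      SkewPolynomial.C (c ^ Fintype.card F) * SkewPolynomial.X := fun c => by
    rw [← SkewPolynomial.monomial_zero_left, SkewPolynomial.X_mul_monomial,
      ← SkewPolynomial.monomial_zero_left, SkewPolynomial.monomial_mul_X]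
    simp [FrobScalars.smul_def]
  exact h c

/-- The degree in `τ` (equal to `0` for the zero polynomial). -/
def natDegree (u : TwistedPolynomial F L) : ℕ := u.support.sup id

/-- The action of `L[τ]` on `L`, where `τ` acts by the `q`-th power map `x ↦ x ^ q`. -/
def eval : TwistedPolynomial F L →ₐ[F] Module.End F L :=
  SkewMonoidAlgebra.liftNCAlgHom (A := FrobScalars F L) (Algebra.lmul F L)
    (powersHom (Module.End F L) (FiniteField.frobeniusAlgHom F L).toLinearMap)
    (by
      intro x n
      refine LinearMap.ext fun z => ?_
      have h : ∀ (n : ℕ) (z : L), ((FiniteField.frobeniusAlgHom F L).toLinearMap ^ n) z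
          = z ^ Fintype.card F ^ n := by
        intro n z
        rw [← frobenius_iterate, Module.End.pow_apply, AlgHom.coe_pow]
        rfl
      have key : ∀ y : L, y ^ Fintype.card F ^ n.toAdd
          * ((FiniteField.frobeniusAlgHom F L).toLinearMap ^ n.toAdd) z
          = ((FiniteField.frobeniusAlgHom F L).toLinearMap ^ n.toAdd) (y * z) := fun y => by
        rw [h, h, mul_pow]
      exact key x)

theorem eval_apply (u : TwistedPolynomial F L) (x : L) :
    eval u x = ∑ i ∈ u.support, TwistedPolynomial.coeff u i * x ^ Fintype.card F ^ i := by
  have h := SkewPolynomial.sum_def (S := L) u (fun i (c : L) => c * x ^ Fintype.card F ^ i)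
  refine Eq.trans ?_ h
  have h1 : SkewPolynomial.sum u (fun i (c : L) => c * x ^ Fintype.card F ^ i) =
    ∑ n ∈ SkewMonoidAlgebra.support u, TwistedPolynomial.coeff u n.toAdd * x ^ Fintype.card F ^ n.toAdd := rfl
  have h2 : eval u = ∑ n ∈ SkewMonoidAlgebra.support u, Algebra.lmul F L (TwistedPolynomial.coeff u n.toAdd) *
    powersHom (Module.End F L) (FiniteField.frobeniusAlgHom F L).toLinearMap n := rfl
  rw [h1, h2, LinearMap.sum_apply]
  refine Finset.sum_congr rfl fun n _ => ?_
  rw [← frobenius_iterate, AlgHom.coe_pow, Module.End.mul_apply, powersHom_apply,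
    Module.End.pow_apply]
  rfl

end TwistedPolynomial
end TwistedPolynomial
/-! ### Places -/

/-- A place of `L`, given by its additive valuation `ord`, which is normalized so that a
uniformizer has order `1`. Every place of a function field over a finite field is of this
form for exactly one `ord`; it is trivial on the constants, see `Place.ord_algebraMap`. -/
structure Place (L : Type*) [Field L] where
  ord : AddValuation L (WithTop ℤ)
  exists_uniformizer : ∃ ϖ : L, ord ϖ = 1

namespace Place
variable {L : Type*} [Field L] 

/-- The order of `x` as an integer; the value `0` at `x = 0` has no meaning. -/
def val (v : Place L) (x : L) : ℤ := (v.ord x).untopD 0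

theorem coe_val (v : Place L) {x : L} (hx : x ≠ 0) : (v.val x : WithTop ℤ) = v.ord x := by
  have := (v.ord.ne_top_iff (x := x)).2 hx
  obtain ⟨n, hn⟩ := WithTop.ne_top_iff_exists.1 this
  simp [val, ← hn]

theorem val_mul (v : Place L) {x y : L} (hx : x ≠ 0) (hy : y ≠ 0) :
    v.val (x * y) = v.val x + v.val y := by
  have h := v.ord.map_mul x y
  rw [← coe_val v hx, ← coe_val v hy, ← coe_val v (mul_ne_zero hx hy)] at h
  exact_mod_cast h

theorem val_one (v : Place L) : v.val 1 = 0 := by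
  simp [val]

theorem val_inv (v : Place L) {x : L} (hx : x ≠ 0) : v.val x⁻¹ = - v.val x := by
  have := val_mul v hx (inv_ne_zero hx)
  rw [mul_inv_cancel₀ hx, val_one] at this
  omega

theorem val_zpow (v : Place L) {x : L} (hx : x ≠ 0) (n : ℤ) : v.val (x ^ n) = n * v.val x := by
  induction n with
  | zero => simp [val_one]
  | succ n ih => rw [zpow_add_one₀ hx, val_mul v (zpow_ne_zero _ hx) hx, ih]; ring
  | pred n ih =>
    rw [zpow_sub_one₀ hx, val_mul v (zpow_ne_zero _ hx) (inv_ne_zero hx), ih, val_inv v hx]; ring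

theorem ext_val {v w : Place L} (h : ∀ x ≠ 0, v.val x = w.val x) : v = w := by
  obtain ⟨v, hv⟩ := v
  obtain ⟨w, hw⟩ := w
  congr
  refine AddValuation.ext fun x => ?_
  rcases eq_or_ne x 0 with rfl | hx
  · simp
  · have h1 := coe_val ⟨v, hv⟩ hx
    have h2 := coe_val ⟨w, hw⟩ hx
    rw [h x hx] at h1
    exact h1.symm.trans h2

theorem eq_of_nonneg {v w : Place L} (h : ∀ x ≠ 0, 0 ≤ v.val x → 0 ≤ w.val x) : v = w := by
  have hunit : ∀ x ≠ 0, v.val x = 0 → w.val x = 0 := fun x hx h0 => by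
    have h1 := h x hx h0.ge
    have h2 := h x⁻¹ (inv_ne_zero hx) (by rw [val_inv v hx]; omega)
    rw [val_inv w hx] at h2
    omega
  have key : ∀ u : Place L, ∃ ϖ : L, ϖ ≠ 0 ∧ u.val ϖ = 1 := fun u => by
    obtain ⟨ϖ, h⟩ := u.exists_uniformizer
    refine ⟨ϖ, ?_, by simp [val, h]⟩
    rintro rfl
    simp at h
  obtain ⟨ϖ, hϖ0, hϖ⟩ := key v
  obtain ⟨ψ, hψ0, hψ⟩ := key w
  have hmul : ∀ x ≠ 0, w.val x = v.val x * w.val ϖ := fun x hx => by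
    have h1 := hunit (x * ϖ ^ (-v.val x)) (mul_ne_zero hx (zpow_ne_zero _ hϖ0)) (by
      rw [val_mul v hx (zpow_ne_zero _ hϖ0), val_zpow v hϖ0, hϖ]; ring)
    rw [val_mul w hx (zpow_ne_zero _ hϖ0), val_zpow w hϖ0] at h1
    linarith
  have h1 := h ϖ hϖ0 (by omega)
  have h2 := hmul ψ hψ0
  rw [hψ] at h2
  have h3 : w.val ϖ = 1 := Int.eq_one_of_mul_eq_one_left h1 h2.symm
  refine ext_val fun x hx => ?_
  rw [hmul x hx, h3, mul_one]

theorem min_val_le_add (v : Place L) {x y : L} (hx : x ≠ 0) (hy : y ≠ 0) (hxy : x + y ≠ 0) :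
    min (v.val x) (v.val y) ≤ v.val (x + y) := by
  have h := v.ord.map_add x y
  rw [← coe_val v hx, ← coe_val v hy, ← coe_val v hxy] at h
  exact_mod_cast h

/-- The real absolute value `2 ^ (- ord x)`; an auxiliary notion. -/
def absVal (v : Place L) : AbsoluteValue L ℝ where
  toFun x := open Classical in if x = 0 then 0 else (2 : ℝ) ^ (-v.val x)
  map_mul' x y := by
    rcases eq_or_ne x 0 with rfl | hx
    · simp
    rcases eq_or_ne y 0 with rfl | hy
    · simp
    simp only [hx, hy, mul_ne_zero hx hy, if_false, val_mul v hx hy]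
    rw [← zpow_add₀ two_ne_zero]
    congr 1
    ring
  nonneg' x := by
    split_ifs <;> positivity
  eq_zero' x := by
    split_ifs with h
    · simp [h]
    · simp [h, zpow_ne_zero]
  add_le' x y := by
    rcases eq_or_ne x 0 with rfl | hx
    · split_ifs <;> simp_all
    rcases eq_or_ne y 0 with rfl | hy
    · split_ifs <;> simp_all
    rcases eq_or_ne (x + y) 0 with hxy | hxy
    · simp only [hx, hy, hxy, if_false, if_true]
      positivity
    simp only [hx, hy, hxy, if_false]
    rcases min_le_iff.1 (min_val_le_add v hx hy hxy) with h | h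
    · exact (zpow_le_zpow_right₀ one_le_two (neg_le_neg h)).trans
        (le_add_of_nonneg_right (by positivity))
    · exact (zpow_le_zpow_right₀ one_le_two (neg_le_neg h)).trans
        (le_add_of_nonneg_left (by positivity))

theorem absVal_apply (v : Place L) {x : L} (hx : x ≠ 0) :
    v.absVal x = (2 : ℝ) ^ (-v.val x) := if_neg hx

theorem absVal_le_one_iff (v : Place L) {x : L} (hx : x ≠ 0) :
    v.absVal x ≤ 1 ↔ 0 ≤ v.val x := by
  rw [absVal_apply v hx, ← zpow_zero (2 : ℝ), zpow_le_zpow_iff_right₀ one_lt_two]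
  omega

theorem absVal_isNontrivial (v : Place L) : v.absVal.IsNontrivial := by
  obtain ⟨ϖ, h⟩ := v.exists_uniformizer
  have h0 : ϖ ≠ 0 := by
    rintro rfl
    simp at h
  refine ⟨ϖ, h0, ?_⟩
  rw [absVal_apply v h0]
  simp [val, h]
  try norm_num

theorem exists_separating {N : ℕ} {v : Fin N → Place L} (hv : Function.Injective v) (i : Fin N) :
    ∃ a : L, a ≠ 0 ∧ (v i).val a < 0 ∧ ∀ j ≠ i, 0 < (v j).val a := by
  have hlt : ∀ (u : Place L) {x : L}, x ≠ 0 → (u.absVal x < 1 ↔ 0 < u.val x) := fun u x hx => by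
    rw [absVal_apply u hx, ← zpow_zero (2 : ℝ), zpow_lt_zpow_iff_right₀ one_lt_two]
    omega
  obtain ⟨a, h1, h2⟩ := AbsoluteValue.exists_one_lt_lt_one_pi_of_not_isEquiv
    (v := fun i => (v i).absVal) (fun i => absVal_isNontrivial _)
    (fun i j hij h => hij (hv (eq_of_nonneg fun x hx h0 => by
      rw [← absVal_le_one_iff _ hx] at h0 ⊢
      exact h.le_one_iff.1 h0))) i
  have ha : a ≠ 0 := by
    rintro rfl
    simp at h1
    linarith
  refine ⟨a, ha, ?_, fun j hj => (hlt _ ha).1 (h2 j hj)⟩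
  by_contra hc
  exact absurd ((absVal_le_one_iff _ ha).2 (not_lt.1 hc)) (not_le.2 h1)

theorem ord_algebraMap {F : Type*} [Field F] [Finite F] [Algebra F L] (v : Place L) {c : F}
    (hc : c ≠ 0) : v.ord (algebraMap F L c) = 0 := by
  have hx : algebraMap F L c ≠ 0 := by simpa using hc
  obtain ⟨n, hn, h⟩ := isOfFinOrder_iff_pow_eq_one.1 (isOfFinOrder_of_finite (Units.mk0 c hc))
  have h' : (algebraMap F L c) ^ (n : ℤ) = 1 := by
    rw [zpow_natCast, ← map_pow]
    have := congrArg Units.val h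
    simp only [Units.val_pow_eq_pow_val, Units.val_mk0, Units.val_one] at this
    rw [this, map_one]
  have h2 := val_zpow v hx n
  rw [h', val_one] at h2
  rw [← coe_val v hx]
  have : v.val (algebraMap F L c) = 0 := by
    rcases mul_eq_zero.1 h2.symm with h | h
    · omega
    · exact h
  simp [this]

theorem ord_algebraMap_nonneg {F : Type*} [Field F] [Finite F] [Algebra F L] (v : Place L)
    (c : F) : 0 ≤ v.ord (algebraMap F L c) := by
  rcases eq_or_ne c 0 with rfl | hc
  · simp
  · exact (ord_algebraMap v hc).ge

theorem ord_aeval_nonneg {F : Type*} [Field F] [Finite F] [Algebra F L] (v : Place L) {x : L}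
    (hx : 0 ≤ v.ord x) (p : F[X]) : 0 ≤ v.ord (aeval x p) := by
  rw [aeval_eq_sum_range]
  refine v.ord.map_le_sum fun i _ => ?_
  rw [Algebra.smul_def, v.ord.map_mul, v.ord.map_pow]
  exact add_nonneg (ord_algebraMap_nonneg v _) (nsmul_nonneg hx i)

theorem ord_aeval_eq_zero {F : Type*} [Field F] [Finite F] [Algebra F L] (v : Place L) {x : L}
    (hx : 0 < v.ord x) {p : F[X]} (hp : p.coeff 0 ≠ 0) : v.ord (aeval x p) = 0 := by
  rw [← X_mul_divX_add p, map_add, map_mul, aeval_X, aeval_C]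
  have h0 := ord_algebraMap (L := L) v hp
  rw [v.ord.map_add_eq_of_lt_right, h0]
  rw [h0, v.ord.map_mul]
  exact lt_of_lt_of_le hx (le_add_of_nonneg_right (ord_aeval_nonneg v hx.le _))

theorem linearIndependent_of_separating {F : Type*} [Field F] [Finite F] [Algebra F L] {x : L}
    (hx : x ≠ 0) {N : ℕ} {v : Fin N → Place L} (hv : ∀ i, 0 < (v i).ord x) {a : Fin N → L}
    (ha : ∀ i, (v i).ord (a i) < 0 ∧ ∀ j ≠ i, 0 < (v j).ord (a i)) (p : Fin N → F[X])
    (hp : ∑ i, aeval x (p i) * a i = 0) : p = 0 := by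
  by_contra hne
  have hex : ∃ m, ∃ i, (p i).coeff m ≠ 0 := by
    by_contra! h
    exact hne (funext fun i => Polynomial.ext fun m => by simpa using h m i)
  classical
  obtain ⟨i, hi⟩ := Nat.find_spec hex
  set m := Nat.find hex
  have hdvd : ∀ j, ∃ r, p j = X ^ m * r := fun j => X_pow_dvd_iff.2 fun d hd => by
    have := Nat.find_min hex hd
    push Not at this
    exact this j
  choose r hr using hdvd
  have hr0 : (r i).coeff 0 ≠ 0 := by
    rw [hr i] at hi
    have := coeff_X_pow_mul (r i) m 0
    rw [zero_add] at this
    rwa [this] at hi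
  have hsum : ∑ j, aeval x (r j) * a j = 0 := by
    refine (mul_eq_zero.1 ?_).resolve_left (pow_ne_zero m hx)
    rw [← hp, Finset.mul_sum]
    refine Finset.sum_congr rfl fun j _ => ?_
    rw [hr j, map_mul, map_pow, aeval_X, mul_assoc]
  rw [← Finset.add_sum_erase _ _ (Finset.mem_univ i)] at hsum
  have h1 : (v i).ord (aeval x (r i) * a i) < 0 := by
    rw [(v i).ord.map_mul, ord_aeval_eq_zero _ (hv i) hr0, zero_add]
    exact (ha i).1
  have h2 : 0 < (v i).ord (∑ j ∈ Finset.univ.erase i, aeval x (r j) * a j) := by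
    refine (v i).ord.map_lt_sum' (by simp) fun j hj => ?_
    rw [(v i).ord.map_mul]
    exact lt_of_lt_of_le ((ha j).2 i (Finset.ne_of_mem_erase hj).symm)
      (le_add_of_nonneg_left (ord_aeval_nonneg _ (hv i).le _))
  rw [eq_neg_of_add_eq_zero_left hsum, (v i).ord.map_neg] at h1
  exact absurd h1 (not_lt.2 h2.le)

open scoped IntermediateField.algebraAdjoinAdjoin in
theorem finite_setOf_ord_pos_aux {F : Type*} [Field F] [Finite F] [Algebra F L] {x : L}
    (hx : x ≠ 0) [FiniteDimensional (IntermediateField.adjoin F {x}) L] :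
    {v : Place L | 0 < v.ord x}.Finite := by
  by_contra hinf
  obtain ⟨t, ht, hcard⟩ := Set.Infinite.exists_subset_card_eq hinf
    (Module.finrank (IntermediateField.adjoin F {x}) L + 1)
  let e := (t.equivFinOfCardEq hcard).symm
  let v : Fin (Module.finrank (IntermediateField.adjoin F {x}) L + 1) → Place L := fun i => e i
  have hv : Function.Injective v := Subtype.val_injective.comp e.injective
  have hpos : ∀ i, 0 < (v i).ord x := fun i => ht (e i).2
  choose a ha0 ha1 ha2 using exists_separating hv
  have hind : LinearIndependent (IntermediateField.adjoin F {x}) a := by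
    rw [← LinearIndependent.iff_fractionRing (Algebra.adjoin F {x})]
    rw [Fintype.linearIndependent_iff]
    intro c hc
    have hp : ∀ i, ∃ p : F[X], aeval x p = (c i : L) := fun i => by
      have h : ∀ y ∈ Algebra.adjoin F {x}, ∃ p : F[X], aeval x p = y := fun y hy => by
        rwa [Algebra.adjoin_singleton_eq_range_aeval] at hy
      exact h _ (c i).2
    choose p hp using hp
    have := linearIndependent_of_separating (F := F) hx hpos (a := a) (fun i => ⟨?_, fun j hj => ?_⟩)
      p (by simpa only [hp] using! hc)
    · intro i
      apply Subtype.ext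
      rw [← hp, this]
      simp
    · rw [← coe_val _ (ha0 i)]
      exact_mod_cast ha1 i
    · rw [← coe_val _ (ha0 i)]
      exact_mod_cast ha2 i j hj
  have := hind.fintype_card_le_finrank
  simp at this

theorem finiteDimensional_adjoin {F : Type*} [Field F] [Algebra F L] [Algebra (RatFunc F) L]
    [IsScalarTower F (RatFunc F) L] [FiniteDimensional (RatFunc F) L] {x : L}
    (hx : Transcendental F x) : FiniteDimensional (IntermediateField.adjoin F {x}) L := by
  have h1 : Algebra.trdeg F (RatFunc F) = 1 := by
    have := IsLocalization.isAlgebraic (R := F[X]) (RatFunc F) (nonZeroDivisors F[X])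
    rw [← _root_.trdeg_add_eq F F[X] (A := RatFunc F), Polynomial.trdeg_of_isDomain,
      trdeg_eq_zero (R := F[X]) (A := RatFunc F), add_zero]
  have h2 := _root_.lift_trdeg_add_eq F (RatFunc F) L
  rw [h1, trdeg_eq_zero (R := RatFunc F) (A := L)] at h2
  have hind : AlgebraicIndependent F (fun _ : Unit => x) :=
    algebraicIndependent_unique_type_iff.2 hx
  have hb : IsTranscendenceBasis F (fun _ : Unit => x) := by
    refine hind.isTranscendenceBasis_of_lift_trdeg_le_of_finite ?_
    have h3 : Algebra.trdeg F L = 1 := by simpa using h2.symm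
    simp [h3]
  have halg := hb.isAlgebraic_field
  rw [Set.range_const] at halg
  have : Algebra.EssFiniteType F (RatFunc F) := by
    have := Algebra.EssFiniteType.of_isLocalization (RatFunc F) (nonZeroDivisors F[X])
    exact Algebra.EssFiniteType.comp F F[X] (RatFunc F)
  have : Algebra.EssFiniteType F L := Algebra.EssFiniteType.comp F (RatFunc F) L
  have : Algebra.EssFiniteType (IntermediateField.adjoin F {x}) L :=
    Algebra.EssFiniteType.of_comp F _ L
  exact Algebra.finite_of_essFiniteType_of_isAlgebraic

theorem finite_setOf_ord_pos (F : Type*) [Field F] [Finite F] [Algebra F L]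
    [Algebra (RatFunc F) L] [IsScalarTower F (RatFunc F) L] [FiniteDimensional (RatFunc F) L]
    {x : L} (hx : x ≠ 0) : {v : Place L | 0 < v.ord x}.Finite := by
  by_cases h : IsAlgebraic F x
  · convert Set.finite_empty
    refine Set.eq_empty_of_forall_notMem fun v hv => ?_
    have := IntermediateField.adjoin.finiteDimensional h.isIntegral
    have : Finite (IntermediateField.adjoin F {x}) := Module.finite_of_finite F
    have := ord_algebraMap (F := IntermediateField.adjoin F {x}) v
      (c := ⟨x, IntermediateField.mem_adjoin_simple_self F x⟩)
      (fun h => hx (congrArg Subtype.val h))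
    have h2 : v.ord x = 0 := this
    exact absurd hv (by simp [h2])
  · have := finiteDimensional_adjoin (F := F) h
    exact finite_setOf_ord_pos_aux (F := F) hx

theorem finite_setOf_ord_ne_zero (F : Type*) [Field F] [Finite F] [Algebra F L]
    [Algebra (RatFunc F) L] [IsScalarTower F (RatFunc F) L] [FiniteDimensional (RatFunc F) L]
    {x : L} (hx : x ≠ 0) : {v : Place L | v.ord x ≠ 0}.Finite := by
  refine ((finite_setOf_ord_pos F hx).union (finite_setOf_ord_pos F (inv_ne_zero hx))).subset
    fun v hv => ?_
  have h1 := coe_val v hx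
  have h2 := coe_val v (inv_ne_zero hx)
  rw [val_inv v hx] at h2
  simp only [Set.mem_ofPred_eq, Set.mem_union, ne_eq] at hv ⊢
  rw [← h1] at hv ⊢
  rw [← h2]
  norm_cast at hv ⊢
  omega

/-- The order of a vector: the minimum of the orders of its entries. -/
def ordVec (v : Place L) {n : ℕ} (x : Fin n → L) : WithTop ℤ :=
  Finset.univ.inf fun i => v.ord (x i)

/-- The order of a polynomial in `L[t]`: the minimum of the orders of its coefficients. -/
def ordPoly (v : Place L) (h : L[X]) : WithTop ℤ :=
  h.support.inf fun i => v.ord (h.coeff i)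

/-- The order at `v` of the coefficient of `x ^ i` in `P`, where `P ∈ L[t][x]`; this is the height
of the point with abscissa `i` of the Newton polygon, for those `i` where the coefficient of
`x ^ i` does not vanish. -/
def newtonHeight (v : Place L) (P : L[X][X]) (i : ℕ) : ℤ := (v.ordPoly (P.coeff i)).untopD 0

/-- The Newton polygon of `P ∈ L[t][x]` at `v` is the lower convex hull of the points
`(i, newtonHeight v P i)`, where `i` runs through the exponents of `x` that occur in `P`.
Its rightmost edge ends in the point whose abscissa is the degree of `P`, and its slope is the
largest slope of a line joining that point to another one of the points. (It is `0` if there is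
no other point.) -/
def lastSlope (v : Place L) (P : L[X][X]) : ℚ :=
  if h : (P.support.erase P.natDegree).Nonempty then
    (P.support.erase P.natDegree).sup' h fun i =>
      ((v.newtonHeight P P.natDegree : ℚ) - v.newtonHeight P i) / ((P.natDegree : ℚ) - i)
  else 0

/-- The line with slope `lastSlope v P` through the right end point of the Newton polygon lies
below all the points and contains a second one. -/
theorem lastSlope_spec (v : Place L) (P : L[X][X])
    (h : (P.support.erase P.natDegree).Nonempty) :
    (∀ i ∈ P.support, (v.newtonHeight P P.natDegree : ℚ) - v.lastSlope P * ((P.natDegree : ℚ) - i)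
      ≤ v.newtonHeight P i) ∧
    ∃ i ∈ P.support, i < P.natDegree ∧
      (v.newtonHeight P P.natDegree : ℚ) - v.lastSlope P * ((P.natDegree : ℚ) - i)
        = v.newtonHeight P i := by
  have hlt : ∀ i ∈ P.support.erase P.natDegree, i < P.natDegree := fun i hi =>
    lt_of_le_of_ne (le_natDegree_of_mem_supp i (Finset.mem_of_mem_erase hi))
      (Finset.ne_of_mem_erase hi)
  have hpos : ∀ i ∈ P.support.erase P.natDegree, (0 : ℚ) < (P.natDegree : ℚ) - i := fun i hi =>
    sub_pos.2 (by exact_mod_cast hlt i hi)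
  rw [lastSlope, dif_pos h]
  constructor
  · intro i hi
    rcases eq_or_ne i P.natDegree with rfl | hne
    · simp
    · have hi' := Finset.mem_erase.2 ⟨hne, hi⟩
      have := Finset.le_sup' (fun i : ℕ => ((v.newtonHeight P P.natDegree : ℚ)
        - v.newtonHeight P i) / ((P.natDegree : ℚ) - i)) hi'
      rw [div_le_iff₀ (hpos i hi')] at this
      linarith
  · obtain ⟨i, hi, he⟩ := Finset.exists_mem_eq_sup' h (fun i : ℕ =>
      ((v.newtonHeight P P.natDegree : ℚ) - v.newtonHeight P i) / ((P.natDegree : ℚ) - i))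
    refine ⟨i, Finset.mem_of_mem_erase hi, hlt i hi, ?_⟩
    rw [he, div_mul_cancel₀ _ (hpos i hi).ne']
    ring

theorem newtonHeight_eq_zero {v : Place L} {P : L[X][X]}
    (hv : ∀ i ∈ P.support, ∀ j ∈ (P.coeff i).support, v.ord ((P.coeff i).coeff j) = 0) (i : ℕ) :
    v.newtonHeight P i = 0 := by
  by_cases hi : i ∈ P.support
  · have h : (P.coeff i).support.Nonempty := by
      simpa [Finset.nonempty_iff_ne_empty] using hi
    have : v.ordPoly (P.coeff i) = 0 := by
      rw [ordPoly, Finset.inf_congr rfl (hv i hi), Finset.inf_const h]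
    simp [newtonHeight, this]
  · simp [newtonHeight, ordPoly, notMem_support_iff.1 hi]

theorem lastSlope_eq_zero {v : Place L} {P : L[X][X]}
    (hv : ∀ i ∈ P.support, ∀ j ∈ (P.coeff i).support, v.ord ((P.coeff i).coeff j) = 0) :
    v.lastSlope P = 0 := by
  unfold lastSlope
  split_ifs with h
  · simp [newtonHeight_eq_zero hv]
  · rfl

end Place

/-! ### Divisors -/

section Divisor

variable (F : Type*) {L : Type*} [Field F] [Finite F] [Field L] [Algebra F L]
  [Algebra (RatFunc F) L] [IsScalarTower F (RatFunc F) L] [FiniteDimensional (RatFunc F) L]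

/-- The divisor `∑ ord_v(x) · v` of a vector `x ≠ 0` (it is the zero divisor for `x = 0`). -/
def vecDiv {n : ℕ} (x : Fin n → L) : Place L →₀ ℤ :=
  Finsupp.ofSupportFinite (fun v => (v.ordVec x).untopD 0) <| by
    refine (Set.finite_iUnion fun i : {i // x i ≠ 0} =>
      Place.finite_setOf_ord_ne_zero F i.2).subset fun v hv => ?_
    by_contra hcon
    simp only [Set.mem_iUnion, Set.mem_ofPred_eq, not_exists, not_not, Subtype.forall] at hcon
    refine hv ?_
    have h : ∀ i, v.ord (x i) = 0 ∨ v.ord (x i) = ⊤ := fun i => by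
      by_cases hi : x i = 0
      · simp [hi]
      · exact Or.inl (hcon i hi)
    have h2 : v.ordVec x = 0 ∨ v.ordVec x = ⊤ := by
      unfold Place.ordVec
      refine Finset.inf_induction (p := fun y : WithTop ℤ => y = 0 ∨ y = ⊤) (Or.inr rfl) ?_
        fun i _ => h i
      rintro _ (rfl | rfl) _ (rfl | rfl) <;> simp
    rcases h2 with h2 | h2 <;> simp [h2]

/-- The divisor `∑ ⌈S_v⌉ · v`, where `S_v` is the slope of the rightmost edge of the Newton polygon
of `P ∈ L[t][x]` at `v`. -/
def slopeDiv (P : L[X][X]) : Place L →₀ ℤ :=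
  Finsupp.ofSupportFinite (fun v => ⌈v.lastSlope P⌉) <| by
    refine (Set.finite_iUnion fun i : P.support =>
      Set.finite_iUnion fun j : (P.coeff i).support =>
      Place.finite_setOf_ord_ne_zero F (mem_support_iff.1 j.2)).subset fun v hv => ?_
    by_contra hcon
    simp only [Set.mem_iUnion, Set.mem_ofPred_eq, not_exists, not_not, Subtype.forall] at hcon
    refine hv ?_
    simp [Place.lastSlope_eq_zero hcon]

/-- The Riemann-Roch space of a divisor, that is, the space of all `f` in `L` that vanish or satisfy
`ord_v(f) + D(v) ≥ 0` for all places `v`. -/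
def riemannRoch (D : Place L →₀ ℤ) : Submodule F L where
  carrier := {f | ∀ v : Place L, ((-D v : ℤ) : WithTop ℤ) ≤ v.ord f}
  zero_mem' v := by simp
  add_mem' hf hg v := v.ord.map_le_add (hf v) (hg v)
  smul_mem' c f hf v := by
    rw [Algebra.smul_def, v.ord.map_mul]
    exact (hf v).trans (le_add_of_nonneg_left (v.ord_algebraMap_nonneg c))

end Divisor

/-! ### Drinfeld modules -/

section DrinfeldModule

variable (F L : Type*) [Field F] [Fintype F] [Field L] [Algebra F L] [Algebra (RatFunc F) L]

/-- The image in `L` of the variable `θ` of the rational function field. -/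
def theta : L := algebraMap (RatFunc F) L RatFunc.X

/-- A Drinfeld `F[t]`-module over `L`: an `F`-algebra homomorphism `φ : F[t] → L[τ]` whose image is
not contained in `L`, and such that the constant coefficient of `φ_t` is `θ`. -/
structure DrinfeldModule where
  φ : F[X] →ₐ[F] TwistedPolynomial F L
  exists_ne_const : ∃ a : F[X], ∀ c : L, φ a ≠ TwistedPolynomial.const F c
  coeff_zero : TwistedPolynomial.coeff (φ X) 0 = theta F L

namespace DrinfeldModule

variable {F L} (E : DrinfeldModule F L)

/-- The rank, that is, the degree of `φ_t` in `τ`. -/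
def rank : ℕ := TwistedPolynomial.natDegree (E.φ X)

/-- The coefficient of `τ ^ j` in `φ_t`. -/
def kappa (j : ℕ) : L := TwistedPolynomial.coeff (E.φ X) j

/-- The value `φ_a(x)`. -/
def act (a : F[X]) (x : L) : L := TwistedPolynomial.eval (E.φ a) x

/-- The associated polynomial `(t - θ) x + κ_1 x ^ q + ⋯ + κ_r x ^ (q ^ r)` in `L[t][x]`. -/
def assocPoly : L[X][X] :=
  C (X - C (theta F L)) * X +
    ∑ j ∈ Finset.Icc 1 E.rank, C (C (E.kappa j)) * X ^ Fintype.card F ^ j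

/-- The divisor `div(E_slope)`. -/
def slopeDivisor [IsScalarTower F (RatFunc F) L] [FiniteDimensional (RatFunc F) L] :
    Place L →₀ ℤ := slopeDiv F E.assocPoly

/-- The group `E(L)`: the additive group of `L`, on which `a ∈ F[t]` acts by `φ_a`. -/
@[nolint unusedArguments]
def Points (_E : DrinfeldModule F L) : Type _ := L

instance : AddCommGroup E.Points := inferInstanceAs (AddCommGroup L)

/-- An element of `L`, regarded as a point of `E`. -/
def point : L ≃+ E.Points := AddEquiv.refl L

theorem act_mul (a b : F[X]) (x : L) : E.act (a * b) x = E.act a (E.act b x) := by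
  simp [act, Module.End.mul_apply]

theorem act_add (a b : F[X]) (x : L) : E.act (a + b) x = E.act a x + E.act b x := by
  simp [act]

instance : Module F[X] E.Points where
  smul a x := E.point (E.act a (E.point.symm x))
  one_smul x := by
    have h : ∀ y : L, E.act 1 y = y := fun y => by simp [act]
    exact h x
  mul_smul a b x := E.act_mul a b x
  smul_zero a := by
    have h : E.act a 0 = 0 := by simp [act]
    exact h
  smul_add a x y := by
    have h : ∀ y z : L, E.act a (y + z) = E.act a y + E.act a z := fun y z => by simp [act]
    exact h x y
  add_smul a b x := E.act_add a b x
  zero_smul x := by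
    have h : ∀ y : L, E.act 0 y = 0 := fun y => by simp [act]
    exact h x

theorem smul_point (a : F[X]) (x : L) : a • E.point x = E.point (E.act a x) := rfl

end DrinfeldModule

end DrinfeldModule

end Drinfeld

end

/-! Suppose `∑ φ_{a_i}(P_i) = 0` is a nontrivial relation of degree `m`. Horner's scheme cuts it
into truncations `g_j` with `g_j = φ_t(g_{j+1}) + ∑ c_{ij} P_i`, where `c_{ij}` is the coefficient
of `t^j` in `a_i`, and with `g_0 = g_{m+1} = 0`.

All `g_j` lie in `W = L(D)` (`truncatedSum_mem_riemannRoch`). Otherwise, at some place, the least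
order among the `g_j` is below `-D(v)`. There `φ_t` strictly decreases orders (`ord_act_X_lt`, read
off the Newton polygon), while every `P_i` has order at least `-D(v)`. So the recursion would
produce a `g_j` of order below the minimum.

The rest is linear algebra (`exists_short_relation`). Going down from `g_m`, the recursion is a walk
in `W` that ends at `0`. The vectors of `W` that reach `0` in at most `k` moves form an increasing
chain of subspaces, stationary from `k = d = dim W` on. So `0` is reached from `g_m` in `d` moves,
which is a relation of degree at most `d` with the same nonzero vector of top coefficients.

Finiteness of `d` (`finiteDimensional_riemannRoch`) comes from embedding `L(D)` into finitely many
finite-dimensional quotients of valuation rings. Injectivity needs a pole for every transcendental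
element, hence the construction of places. -/

noncomputable section

namespace Drinfeld

/-! ### Quotients `R/xR` are finite-dimensional over the constants -/

section FiniteQuotient

variable {F L : Type*} [Field F] [Field L] [Algebra F L]

/-- If the `b i` are linearly independent over `F` modulo `x`, they satisfy no nontrivial linear
relation with coefficients in `F[x]`. -/
theorem eq_zero_of_sum_aeval_mul_eq_zero {R : Type*} [CommRing R] [IsDomain R] [Algebra F R]
    {x : R} (hx : x ≠ 0) {ι : Type*} [Fintype ι] {b : ι → R}
    (hb : LinearIndependent F fun i => Ideal.Quotient.mk (Ideal.span {x}) (b i))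
    (p : ι → F[X]) (hp : ∑ i, aeval x (p i) * b i = 0) : p = 0 := by
  by_contra hne
  have hex : ∃ m, ∃ i, (p i).coeff m ≠ 0 := by
    by_contra! h
    exact hne (funext fun i => Polynomial.ext fun m => by simpa using h m i)
  classical
  obtain ⟨i, hi⟩ := Nat.find_spec hex
  -- Dividing by the largest power of `x` common to all `p j` leaves some nonzero constant term,
  -- which survives reduction modulo `x`.
  set m := Nat.find hex
  have hdvd : ∀ j, ∃ r, p j = X ^ m * r := fun j => X_pow_dvd_iff.2 fun d hd => by
    have := Nat.find_min hex hd
    push Not at this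
    exact this j
  choose r hr using hdvd
  have hsum : ∑ j, aeval x (r j) * b j = 0 := by
    refine (mul_eq_zero.1 ?_).resolve_left (pow_ne_zero m hx)
    rw [← hp, Finset.mul_sum]
    refine Finset.sum_congr rfl fun j _ => ?_
    rw [hr j, map_mul, map_pow, aeval_X, mul_assoc]
  have hmod : ∑ j, (r j).coeff 0 • Ideal.Quotient.mk (Ideal.span {x}) (b j) = 0 := by
    have h0 : Ideal.Quotient.mk (Ideal.span {x}) x = 0 :=
      Ideal.Quotient.eq_zero_iff_mem.2 (Ideal.mem_span_singleton_self x)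
    have h1 := congrArg (Ideal.Quotient.mk (Ideal.span {x})) hsum
    rw [map_sum, map_zero] at h1
    rw [← h1]
    refine Finset.sum_congr rfl fun j _ => ?_
    have h2 : Ideal.Quotient.mk (Ideal.span {x}) (aeval x (r j))
        = algebraMap F _ ((r j).coeff 0) := by
      rw [← X_mul_divX_add (r j), map_add, map_mul, aeval_X, aeval_C, map_add, map_mul, h0]
      simp [Ideal.Quotient.mk_algebraMap]
    rw [map_mul, h2, Algebra.smul_def]
  refine hi ?_
  rw [hr i]
  have h3 := coeff_X_pow_mul (r i) m 0
  rw [zero_add] at h3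
  rw [h3]
  exact Fintype.linearIndependent_iff.1 hb _ hmod i

-- Lifts to `R` of vectors independent over `F` in the quotient are independent over `F(x)` in `L`,
-- so the dimension of the quotient is at most `[L : F(x)]`.
open scoped IntermediateField.algebraAdjoinAdjoin in
theorem finite_quotient_span_singleton_of_finiteDimensional_adjoin (R : Subalgebra F L) {x : R}
    (hx : x ≠ 0) [FiniteDimensional (IntermediateField.adjoin F {(x : L)}) L] :
    Module.Finite F (R ⧸ Ideal.span {x}) := by
  have := Module.Free.of_divisionRing F (R ⧸ Ideal.span {x})
  rw [← Module.rank_lt_aleph0_iff]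
  refine lt_of_le_of_lt (rank_le (n := Module.finrank (IntermediateField.adjoin F {(x : L)}) L)
    fun s hs => ?_) (Cardinal.natCast_lt_aleph0)
  choose b hb using fun i : s => Ideal.Quotient.mk_surjective (i : R ⧸ Ideal.span {x})
  have hind : LinearIndependent (IntermediateField.adjoin F {(x : L)}) fun i => (b i : L) := by
    -- Clearing denominators reduces to coefficients in `F[x]`.
    rw [← LinearIndependent.iff_fractionRing (Algebra.adjoin F {(x : L)})]
    rw [Fintype.linearIndependent_iff]
    intro c hc
    have hp : ∀ i, ∃ p : F[X], aeval (x : L) p = (c i : L) := fun i => by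
      have h : ∀ y ∈ Algebra.adjoin F {(x : L)}, ∃ p : F[X], aeval (x : L) p = y := fun y hy => by
        rwa [Algebra.adjoin_singleton_eq_range_aeval] at hy
      exact h _ (c i).2
    choose p hp using hp
    have := eq_zero_of_sum_aeval_mul_eq_zero (F := F) hx (b := b) (by simpa only [hb] using hs) p (by
      apply Subtype.ext
      have hcoe : ∀ q : F[X], ((aeval x q : R) : L) = aeval (x : L) q := fun q =>
        (aeval_algHom_apply R.val x q).symm
      rw [AddSubmonoidClass.coe_finsetSum]
      simp only [MulMemClass.coe_mul]
      simpa only [hcoe, hp] using! hc)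
    intro i
    apply Subtype.ext
    rw [← hp, this]
    simp
  rw [← Fintype.card_coe]
  exact hind.fintype_card_le_finrank

variable [Algebra (RatFunc F) L] [IsScalarTower F (RatFunc F) L] [FiniteDimensional (RatFunc F) L]

theorem finite_quotient_span_singleton (R : Subalgebra F L) {x : R}
    (hx : Transcendental F (x : L)) : Module.Finite F (R ⧸ Ideal.span {x}) := by
  have := Place.finiteDimensional_adjoin hx
  refine finite_quotient_span_singleton_of_finiteDimensional_adjoin R ?_
  rintro rfl
  exact hx (by simpa using isAlgebraic_zero)

end FiniteQuotient

/-! ### Existence of places -/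

section PlaceExistence

open IsDedekindDomain

/-- The place attached to a normalized multiplicative valuation. -/
def Place.ofValuation {L : Type*} [Field L] (w : Valuation L (WithZero (Multiplicative ℤ)))
    (hw : ∃ ϖ : L, w ϖ = WithZero.exp (-1 : ℤ)) : Place L where
  ord := AddValuation.of (fun x => open Classical in
      if x = 0 then (⊤ : WithTop ℤ) else ((-(w x).log : ℤ) : WithTop ℤ))
    (by simp) (by simp)
    (fun x y => by
      rcases eq_or_ne x 0 with rfl | hx
      · rw [zero_add]
        exact min_le_right _ _
      rcases eq_or_ne y 0 with rfl | hy
      · rw [add_zero]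
        exact min_le_left _ _
      rcases eq_or_ne (x + y) 0 with hxy | hxy
      · simp [hxy]
      have h := w.map_add x y
      simp only [hx, hy, hxy, if_false]
      have h1 : ∀ {z : L}, z ≠ 0 → w z ≠ 0 := fun hz => (w.ne_zero_iff).2 hz
      rw [le_max_iff, ← WithZero.log_le_log (h1 hxy) (h1 hx),
        ← WithZero.log_le_log (h1 hxy) (h1 hy)] at h
      rw [min_le_iff]
      norm_cast
      omega)
    (fun x y => by
      rcases eq_or_ne x 0 with rfl | hx
      · simp
      rcases eq_or_ne y 0 with rfl | hy
      · simp
      have h1 : ∀ {z : L}, z ≠ 0 → w z ≠ 0 := fun hz => (w.ne_zero_iff).2 hz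
      simp only [hx, hy, mul_ne_zero hx hy, if_false, map_mul,
        WithZero.log_mul (h1 hx) (h1 hy)]
      norm_cast
      ring)
  exists_uniformizer := by
    obtain ⟨ϖ, h⟩ := hw
    refine ⟨ϖ, ?_⟩
    have h0 : ϖ ≠ 0 := by
      rintro rfl
      rw [map_zero] at h
      exact WithZero.exp_ne_zero h.symm
    simp [h0, h]

theorem Place.ofValuation_ord_pos {L : Type*} [Field L]
    (w : Valuation L (WithZero (Multiplicative ℤ))) (hw : ∃ ϖ : L, w ϖ = WithZero.exp (-1 : ℤ))
    {x : L} (hx : w x < 1) : 0 < (Place.ofValuation w hw).ord x := by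
  rcases eq_or_ne x 0 with rfl | h0
  · simp
  have h1 : w x ≠ 0 := (w.ne_zero_iff).2 h0
  rw [← WithZero.log_lt_log h1 one_ne_zero, WithZero.log_one] at hx
  simp only [Place.ofValuation, AddValuation.of_apply, h0, if_false]
  exact_mod_cast neg_pos.2 hx

/-- The element generates a finite field, whose unit group is finite. -/
theorem exists_pow_eq_one_of_isAlgebraic (F : Type*) {L : Type*} [Field F] [Finite F] [Field L]
    [Algebra F L] {x : L} (hx : x ≠ 0) (h : IsAlgebraic F x) :
    ∃ n, 0 < n ∧ x ^ n = 1 := by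
  have := IntermediateField.adjoin.finiteDimensional h.isIntegral
  have : Finite (IntermediateField.adjoin F {x}) := Module.finite_of_finite F
  let y : IntermediateField.adjoin F {x} := ⟨x, IntermediateField.mem_adjoin_simple_self F x⟩
  have hy : y ≠ 0 := fun h => hx (congrArg Subtype.val h)
  obtain ⟨n, hn, h⟩ := isOfFinOrder_iff_pow_eq_one.1 (isOfFinOrder_of_finite (Units.mk0 y hy))
  refine ⟨n, hn, ?_⟩
  have := congrArg (fun u : (IntermediateField.adjoin F {x})ˣ =>
    ((u : IntermediateField.adjoin F {x}) : L)) h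
  simpa [y] using this

variable (F : Type*) {L : Type*} [Field F] [Finite F] [Field L] [Algebra F L]
  [Algebra (RatFunc F) L] [IsScalarTower F (RatFunc F) L] [FiniteDimensional (RatFunc F) L]

theorem ValuationSubring.finite_quotient_span_singleton (V : ValuationSubring L)
    (hF : ∀ c : F, algebraMap F L c ∈ V) {z : V} (hz : z ≠ 0) : Finite (V ⧸ Ideal.span {z}) := by
  by_cases h : IsAlgebraic F (z : L)
  · obtain ⟨n, hn, h1⟩ := exists_pow_eq_one_of_isAlgebraic F (fun h => hz (Subtype.ext h)) h
    have hu : IsUnit z := IsUnit.of_pow_eq_one (Subtype.ext h1) hn.ne'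
    rw [Ideal.span_singleton_eq_top.2 hu]
    infer_instance
  · let R : Subalgebra F L := { V.toSubring with algebraMap_mem' := hF }
    have := Drinfeld.finite_quotient_span_singleton R (x := z) h
    exact Module.finite_of_finite F (M := R ⧸ Ideal.span {(z : R)})

/-- For `z ≠ 0` in `I`, both `(z)` and the finite module `I/(z)` are finitely generated. -/
theorem isNoetherianRing_of_finite_quotient {R : Type*} [CommRing R]
    (h : ∀ z : R, z ≠ 0 → Finite (R ⧸ Ideal.span {z})) : IsNoetherianRing R := by
  rw [isNoetherianRing_iff_ideal_fg]
  intro I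
  by_cases hI : I = ⊥
  · rw [hI]
    exact Submodule.fg_bot
  obtain ⟨z, hz, hz0⟩ := Submodule.exists_mem_ne_zero_of_ne_bot hI
  have := h z hz0
  refine Submodule.fg_of_fg_map_of_fg_inf_ker (Ideal.span {z}).mkQ ?_ ?_
  · exact Submodule.FG.of_finite
  · rw [Submodule.ker_mkQ, inf_eq_right.2 ((Ideal.span_singleton_le_iff_mem I).2 hz)]
    exact Submodule.fg_span_singleton z

/-- Since `y` is not a unit of `F[y]`, some valuation ring of `L` contains `F[y]` and has `y` as a
nonunit. Its quotients by nonzero principal ideals are finite, so it is Noetherian, hence discrete,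
and its normalized valuation is the place. -/
theorem exists_place_ord_pos {y : L} (hy : Transcendental F y) : ∃ v : Place L, 0 < v.ord y := by
  let A : Subring L := (Algebra.adjoin F {y}).toSubring
  let y' : A := ⟨y, Algebra.subset_adjoin rfl⟩
  have hI : Ideal.span {y'} ≠ ⊤ := by
    rw [Ne, Ideal.span_singleton_eq_top]
    intro hu
    obtain ⟨⟨b, hb⟩, h⟩ := hu.exists_right_inv
    replace hb : b ∈ Algebra.adjoin F {y} := hb
    rw [Algebra.adjoin_singleton_eq_range_aeval] at hb
    obtain ⟨p, rfl⟩ := hb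
    have h1 : y * aeval y p = 1 := congrArg Subtype.val h
    -- An inverse of `y` in `F[y]` would give a polynomial with root `y` and constant term `-1`.
    have h2 : aeval y (X * p - 1) = 0 := by simp [h1]
    have h3 := (transcendental_iff.1 hy) _ h2
    have h4 := congrArg (fun q => coeff q 0) h3
    simp at h4
  obtain ⟨V, hAV, hyV⟩ := Ideal.image_subset_nonunits_valuationSubring _ hI
  have hF : ∀ c : F, algebraMap F L c ∈ V := fun c =>
    hAV (Subalgebra.algebraMap_mem (Algebra.adjoin F {y}) c)
  have hyV : y ∈ V.nonunits := hyV ⟨y', Ideal.mem_span_singleton_self y', rfl⟩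
  rw [← SetLike.mem_coe, ← ValuationSubring.image_maximalIdeal] at hyV
  obtain ⟨z, hz, rfl⟩ := hyV
  have hz0 : z ≠ 0 := by
    rintro rfl
    exact hy (by simpa using isAlgebraic_zero)
  have hfield : ¬ IsField V := fun hf =>
    (IsLocalRing.mem_maximalIdeal z).1 hz (by
      obtain ⟨w, hw⟩ := hf.mul_inv_cancel hz0
      exact IsUnit.of_mul_eq_one w hw)
  have : IsNoetherianRing V := isNoetherianRing_of_finite_quotient fun _ h =>
    ValuationSubring.finite_quotient_span_singleton F V hF h
  have : IsDiscreteValuationRing V :=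
    ((IsDiscreteValuationRing.TFAE V hfield).out 0 1 :
      IsDiscreteValuationRing V ↔ ValuationRing V).2 inferInstance
  let m := IsDiscreteValuationRing.maximalIdeal V
  refine ⟨Place.ofValuation (m.valuation L) (m.valuation_exists_uniformizer L),
    Place.ofValuation_ord_pos _ _ ?_⟩
  exact by
    have h := HeightOneSpectrum.valuation_lt_one_iff_mem (K := L) m z
    exact h.2 hz

end PlaceExistence

/-! ### Finite dimension of Riemann-Roch spaces -/

section RiemannRoch

variable (F : Type*) {L : Type*} [Field F] [Finite F] [Field L] [Algebra F L]

/-- The valuation ring of a place, as an algebra over the constants. -/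
def Place.integers (v : Place L) : Subalgebra F L where
  carrier := {x | 0 ≤ v.ord x}
  mul_mem' hx hy := by
    simp only [Set.mem_ofPred_eq, v.ord.map_mul] at *
    exact add_nonneg hx hy
  add_mem' hx hy := v.ord.map_le_add hx hy
  algebraMap_mem' c := v.ord_algebraMap_nonneg c

theorem Place.transcendental_of_ord_ne_zero (v : Place L) {x : L} (hx : x ≠ 0)
    (h : v.ord x ≠ 0) : Transcendental F x := fun halg => by
  obtain ⟨n, hn, h1⟩ := exists_pow_eq_one_of_isAlgebraic F hx halg
  have h2 := v.val_zpow hx n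
  rw [zpow_natCast, h1, v.val_one] at h2
  have h3 : v.val x = 0 := by
    rcases mul_eq_zero.1 h2.symm with h | h
    · omega
    · exact h
  exact h (by rw [← v.coe_val hx, h3]; rfl)

theorem Place.exists_ord_eq (v : Place L) (n : ℕ) : ∃ x : L, x ≠ 0 ∧ v.ord x = (n : ℤ) := by
  obtain ⟨ϖ, h⟩ := v.exists_uniformizer
  have h0 : ϖ ≠ 0 := by
    rintro rfl
    simp at h
  refine ⟨ϖ ^ n, pow_ne_zero n h0, ?_⟩
  rw [v.ord.map_pow, h]
  simp

variable [Algebra (RatFunc F) L] [IsScalarTower F (RatFunc F) L] [FiniteDimensional (RatFunc F) L]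

/-- A pole of `x` is a zero of `x⁻¹`. -/
theorem exists_place_ord_neg {x : L} (hx : Transcendental F x) : ∃ v : Place L, v.ord x < 0 := by
  have h0 : x ≠ 0 := by
    rintro rfl
    exact hx isAlgebraic_zero
  obtain ⟨v, hv⟩ := exists_place_ord_pos F (y := x⁻¹) fun h => hx (by simpa using h.inv)
  refine ⟨v, ?_⟩
  rw [← v.coe_val (inv_ne_zero h0), v.val_inv h0] at hv
  rw [← v.coe_val h0]
  norm_cast at hv ⊢
  omega

theorem exists_place (F : Type*) {L : Type*} [Field F] [Finite F] [Field L] [Algebra F L]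
    [Algebra (RatFunc F) L] [IsScalarTower F (RatFunc F) L] [FiniteDimensional (RatFunc F) L] :
    Nonempty (Place L) := by
  obtain ⟨v, -⟩ := exists_place_ord_pos F (L := L) (y := algebraMap (RatFunc F) L RatFunc.X) (by
    rw [transcendental_algebraMap_iff (algebraMap (RatFunc F) L).injective]
    exact RatFunc.transcendental_X)
  exact ⟨v⟩

/-- Multiplication by a suitable `x v` maps the space into each valuation ring with `v ∈ S`. Modulo
`(x v)²` the combined map is injective: an `f ≠ 0` in the kernel would vanish on `S` and have no
pole elsewhere, yet a transcendental element has a pole. -/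
theorem finiteDimensional_riemannRoch (D : Place L →₀ ℤ) :
    FiniteDimensional F (riemannRoch F D) := by
  classical
  obtain ⟨v₀⟩ := exists_place F (L := L)
  -- The extra place `v₀` forces a zero on kernel elements even when `D = 0`; this excludes nonzero
  -- constants.
  let S : Finset (Place L) := insert v₀ D.support
  -- Order `|D(v)|` would make `x v * f` integral; the extra `1` gives the multiples of `x v`
  -- strictly positive order.
  choose x hx0 hx using fun v : Place L => v.exists_ord_eq ((D v).natAbs + 1)
  have hxO : ∀ v, x v ∈ v.integers F := fun v => by
    change 0 ≤ v.ord (x v)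
    rw [hx]
    exact_mod_cast Nat.zero_le _
  -- The square is used because `x v * f ∈ (x v)²` means `f ∈ (x v)`.
  let y : ∀ v : Place L, v.integers F := fun v => ⟨x v, hxO v⟩ ^ 2
  have hfin : ∀ v : Place L, Module.Finite F (v.integers F ⧸ Ideal.span {y v}) := fun v => by
    refine finite_quotient_span_singleton _ (v.transcendental_of_ord_ne_zero F (pow_ne_zero 2 (hx0 v)) ?_)
    change v.ord (x v ^ 2) ≠ 0
    rw [v.ord.map_pow, hx, two_nsmul]
    norm_cast
  have hmem : ∀ v : Place L, ∀ f ∈ riemannRoch F D, x v * f ∈ v.integers F := fun v f hf => by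
    change 0 ≤ v.ord (x v * f)
    have h1 : ((-D v : ℤ) : WithTop ℤ) ≤ v.ord f := hf v
    rw [v.ord.map_mul, hx]
    refine le_trans ?_ (add_le_add_right h1 _)
    norm_cast
    omega
  let Φ : riemannRoch F D →ₗ[F] ∀ v : S, (v.1.integers F ⧸ Ideal.span {y v.1}) :=
    LinearMap.pi fun v => (Ideal.Quotient.mkₐ F (Ideal.span {y v.1})).toLinearMap ∘ₗ
      LinearMap.codRestrict (Subalgebra.toSubmodule (v.1.integers F))
        (Algebra.lmul F L (x v.1) ∘ₗ (riemannRoch F D).subtype) fun f => hmem v.1 f f.2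
  refine FiniteDimensional.of_injective Φ ?_
  rw [← LinearMap.ker_eq_bot, LinearMap.ker_eq_bot']
  rintro ⟨f, hf⟩ hΦ
  have hS : ∀ v ∈ S, f ≠ 0 → 0 < v.ord f := fun v hv _ => by
    have h1 : Ideal.Quotient.mk (Ideal.span {y v}) ⟨x v * f, hmem v f hf⟩ = 0 :=
      congrFun hΦ ⟨v, hv⟩
    rw [Ideal.Quotient.eq_zero_iff_mem, Ideal.mem_span_singleton'] at h1
    obtain ⟨⟨a, ha⟩, h⟩ := h1
    have h2 : a * x v ^ 2 = x v * f := congrArg Subtype.val h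
    have h3 : f = a * x v := mul_left_cancel₀ (hx0 v) (by rw [← h2]; ring)
    have ha : 0 ≤ v.ord a := ha
    rw [h3, v.ord.map_mul, hx]
    refine lt_of_lt_of_le ?_ (le_add_of_nonneg_left ha)
    norm_cast
    omega
  refine Subtype.ext ?_
  by_contra hf0
  replace hf0 : f ≠ 0 := hf0
  have h₀ := hS v₀ (Finset.mem_insert_self _ _) hf0
  obtain ⟨v, hv⟩ := exists_place_ord_neg F (v₀.transcendental_of_ord_ne_zero F hf0 h₀.ne')
  by_cases hvS : v ∈ S
  · exact absurd (hS v hvS hf0) hv.not_gt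
  · have hDv : D v = 0 := Finsupp.notMem_support_iff.1 fun h => hvS (Finset.mem_insert_of_mem h)
    have h1 : ((-D v : ℤ) : WithTop ℤ) ≤ v.ord f := hf v
    rw [hDv] at h1
    exact absurd hv (not_lt.2 (by simpa using h1))

end RiemannRoch

/-! ### Shortening walks in a finite-dimensional space -/

section Descent

variable {K V U : Type*} [Field K] [AddCommGroup V] [Module K V] [AddCommGroup U] [Module K U]

/-- The vectors of `W` from which the origin is reached in at most `k` moves of the form
`x ↦ T x + Q u` without leaving `W`. -/
def reachSubmodule (W : Submodule K V) (T : V →ₗ[K] V) (Q : U →ₗ[K] V) : ℕ → Submodule K V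
  | 0 => ⊥
  | k + 1 => W ⊓ (reachSubmodule W T Q k ⊔ LinearMap.range Q).comap T

variable (W : Submodule K V) (T : V →ₗ[K] V) (Q : U →ₗ[K] V)

theorem reachSubmodule_le (k : ℕ) : reachSubmodule W T Q k ≤ W := by
  cases k with
  | zero => exact bot_le
  | succ k => exact inf_le_left

theorem reachSubmodule_monotone : Monotone (reachSubmodule W T Q) := by
  refine monotone_nat_of_le_succ fun k => ?_
  induction k with
  | zero => exact bot_le
  | succ k ih => exact inf_le_inf_left W (Submodule.comap_mono (sup_le_sup_right ih _))

/-- Each term of the chain is determined by its predecessor. -/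
theorem reachSubmodule_eq_of_succ_eq {k : ℕ}
    (h : reachSubmodule W T Q (k + 1) = reachSubmodule W T Q k) (m : ℕ) :
    reachSubmodule W T Q (k + m) = reachSubmodule W T Q k := by
  induction m with
  | zero => rfl
  | succ m ih =>
    rw [← add_assoc, reachSubmodule, ih]
    exact h

theorem reachSubmodule_le_finrank [FiniteDimensional K W] (m : ℕ) :
    reachSubmodule W T Q m ≤ reachSubmodule W T Q (Module.finrank K W) := by
  have hfin : ∀ k, FiniteDimensional K (reachSubmodule W T Q k) := fun k =>
    Submodule.finiteDimensional_of_le (reachSubmodule_le W T Q k)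
  obtain ⟨k, hk, h⟩ : ∃ k ≤ Module.finrank K W,
      reachSubmodule W T Q (k + 1) = reachSubmodule W T Q k := by
    by_contra! hne
    -- If every inclusion up to this point were strict, the dimensions would exceed that of `W`.
    have hlt : ∀ k ≤ Module.finrank K W + 1,
        k ≤ Module.finrank K (reachSubmodule W T Q k) := fun k => by
      induction k with
      | zero => simp
      | succ k ih =>
        intro hk
        have h1 : reachSubmodule W T Q k < reachSubmodule W T Q (k + 1) :=
          lt_of_le_of_ne (reachSubmodule_monotone W T Q k.le_succ) (hne k (by omega)).symm
        have := Submodule.finrank_lt_finrank_of_lt h1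
        have := ih (by omega)
        omega
    have h1 := hlt _ le_rfl
    have h2 := Submodule.finrank_mono (reachSubmodule_le W T Q (Module.finrank K W + 1))
    omega
  refine le_trans ?_ (reachSubmodule_monotone W T Q hk)
  rcases le_total m k with hmk | hkm
  · exact reachSubmodule_monotone W T Q hmk
  · obtain ⟨n, rfl⟩ := Nat.exists_eq_add_of_le hkm
    exact (reachSubmodule_eq_of_succ_eq W T Q h n).le

theorem exists_sum_eq_zero_of_mem_reachSubmodule {k : ℕ} {x : V}
    (hx : x ∈ reachSubmodule W T Q k) :
    ∃ u : ℕ → U, (T ^ k) x + ∑ j ∈ Finset.range k, (T ^ j) (Q (u j)) = 0 := by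
  induction k generalizing x with
  | zero =>
    refine ⟨0, ?_⟩
    have : x = 0 := hx
    simp [this]
  | succ k ih =>
    obtain ⟨y, hy, _, ⟨w, rfl⟩, h⟩ := Submodule.mem_sup.1 hx.2
    obtain ⟨u, hu⟩ := ih hy
    -- The first move out of `x` is `y = T x - Q w`; the remaining `k` moves apply `T ^ k` to it, so
    -- `-w` is the entry of index `k`.
    refine ⟨Function.update u k (-w), ?_⟩
    rw [Finset.sum_range_succ, Function.update_self, pow_succ, Module.End.mul_apply,
      ← h, map_add, map_neg, map_neg, Finset.sum_congr rfl fun j hj => by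
        rw [Function.update_of_ne (Finset.mem_range.1 hj).ne], ← hu]
    abel

/-- The walk `g m, …, g 0 = 0` is replaced by one from `g m` with `dim W` moves. Prescribing the top
entry keeps the new relation nontrivial when `u m ≠ 0`. -/
theorem exists_short_relation [FiniteDimensional K W] {g : ℕ → V} {u : ℕ → U}
    (hg : ∀ j, g j = T (g (j + 1)) + Q (u j)) (hW : ∀ j, g j ∈ W) (h0 : g 0 = 0) {m : ℕ}
    (hm : g (m + 1) = 0) :
    ∃ u' : ℕ → U, u' (Module.finrank K W) = u m ∧
      ∑ j ∈ Finset.range (Module.finrank K W + 1), (T ^ j) (Q (u' j)) = 0 := by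
  have hmem : ∀ j, g j ∈ reachSubmodule W T Q j := fun j => by
    induction j with
    | zero => exact h0
    | succ j ih =>
      refine ⟨hW _, Submodule.mem_sup.2 ⟨g j, ih, -Q (u j), ⟨-u j, map_neg _ _⟩, ?_⟩⟩
      rw [hg j]
      abel
  obtain ⟨u', hu'⟩ := exists_sum_eq_zero_of_mem_reachSubmodule W T Q
    (reachSubmodule_le_finrank W T Q m (hmem m))
  -- As `g (m + 1) = 0`, the starting point `g m` is `Q (u m)` itself and becomes the top term.
  refine ⟨Function.update u' (Module.finrank K W) (u m), Function.update_self .., ?_⟩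
  rw [Finset.sum_range_succ, Function.update_self, Finset.sum_congr rfl fun j hj => by
    rw [Function.update_of_ne (Finset.mem_range.1 hj).ne], ← hu', hg m, hm, map_zero, zero_add]
  abel

end Descent

/-! ### Degrees and constants of twisted polynomials -/

namespace TwistedPolynomial

theorem le_natDegree_of_mem_support {F L : Type*} [Field L] {u : TwistedPolynomial F L} {i : ℕ}
    (hi : i ∈ u.support) : i ≤ u.natDegree :=
  Finset.le_sup (f := id) hi

theorem mem_support_iff {F L : Type*} [Field L] {u : TwistedPolynomial F L} {i : ℕ} :
    i ∈ u.support ↔ coeff u i ≠ 0 :=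
  SkewPolynomial.mem_support_iff

theorem eq_const_of_natDegree_eq_zero {F L : Type*} [Field L] {u : TwistedPolynomial F L}
    (h : u.natDegree = 0) :
    u = const F (coeff u 0) := by
  refine SkewPolynomial.ext fun n => ?_
  rcases Nat.eq_zero_or_pos n with rfl | hn
  · exact SkewPolynomial.coeff_C_zero.symm
  · refine Eq.trans ?_ (SkewPolynomial.coeff_C_ne_zero hn.ne').symm
    refine SkewPolynomial.notMem_support_iff.1 fun hmem => ?_
    have := le_natDegree_of_mem_support hmem
    omega

theorem algebraMap_eq_const {F L : Type*} [Field F] [Fintype F] [Field L] [Algebra F L] (c : F) :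
    algebraMap F (TwistedPolynomial F L) c = const F (algebraMap F L c) := rfl

theorem const_add {F L : Type*} [Field L] (c d : L) : const F (c + d) = const F c + const F d :=
  SkewPolynomial.C_add (R := FrobScalars F L)

theorem const_mul {F L : Type*} [Field F] [Fintype F] [Field L] [Algebra F L] (c d : L) : const F (c * d) = const F c * const F d :=
  SkewPolynomial.C_mul (R := FrobScalars F L)

end TwistedPolynomial

theorem theta_ne_zero {F L : Type*} [Field F] [Field L] [Algebra (RatFunc F) L] :
    theta F L ≠ 0 := by
  simp [theta, RatFunc.X_ne_zero]

/-! ### The Newton polygon and the growth of `φ_t` -/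

namespace DrinfeldModule

section

variable {F L : Type*} [Field F] [Fintype F] [Field L] [Algebra F L] [Algebra (RatFunc F) L]
  (E : DrinfeldModule F L)

/-- If `φ_t` were constant, so would be every `φ_a`, as `t` generates `F[t]` over `F`. -/
theorem rank_pos : 0 < E.rank := by
  rw [Nat.pos_iff_ne_zero]
  intro h0
  obtain ⟨κ, hX⟩ : ∃ c, E.φ X = TwistedPolynomial.const F c :=
    ⟨_, TwistedPolynomial.eq_const_of_natDegree_eq_zero h0⟩
  have hC : ∀ c, E.φ (C c) = TwistedPolynomial.const F (algebraMap F L c) := fun c =>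
    (E.φ.commutes c).trans (TwistedPolynomial.algebraMap_eq_const c)
  have hall : ∀ a, ∃ c, E.φ a = TwistedPolynomial.const F c := fun a => by
    induction a using Polynomial.induction_on with
    | C c => exact ⟨_, hC c⟩
    | add p q hp hq =>
      obtain ⟨c, hc⟩ := hp
      obtain ⟨d, hd⟩ := hq
      exact ⟨c + d, by rw [map_add, hc, hd, TwistedPolynomial.const_add]⟩
    | monomial n c h =>
      obtain ⟨d, hd⟩ := h
      exact ⟨d * κ, by rw [pow_succ, ← mul_assoc, map_mul, hd, hX, TwistedPolynomial.const_mul]⟩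
  obtain ⟨a, ha⟩ := E.exists_ne_const
  obtain ⟨c, hc⟩ := hall a
  exact ha c hc

theorem kappa_rank_ne_zero : E.kappa E.rank ≠ 0 := by
  have hne : (E.φ X).support.Nonempty := by
    rw [Finset.nonempty_iff_ne_empty]
    intro h
    have := E.rank_pos
    simp [rank, TwistedPolynomial.natDegree, h] at this
  obtain ⟨i, hi, h⟩ := Finset.exists_mem_eq_sup _ hne id
  have : E.rank = i := h
  rw [this]
  exact TwistedPolynomial.mem_support_iff.1 hi

theorem act_X (x : L) :
    E.act X x = ∑ i ∈ Finset.range (E.rank + 1), E.kappa i * x ^ Fintype.card F ^ i := by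
  rw [act, TwistedPolynomial.eval_apply]
  refine Finset.sum_subset (fun i hi => Finset.mem_range.2
    (Nat.lt_succ_of_le (TwistedPolynomial.le_natDegree_of_mem_support hi))) fun i _ hi => ?_
  have : TwistedPolynomial.coeff (E.φ X) i = 0 := by
    by_contra h
    exact hi (TwistedPolynomial.mem_support_iff.2 h)
  rw [this, zero_mul]

theorem card_pow_injective : Function.Injective fun j : ℕ => Fintype.card F ^ j :=
  Nat.pow_right_injective Fintype.one_lt_card

theorem assocPoly_coeff_one : E.assocPoly.coeff 1 = X - C (theta F L) := by
  have hq : ∀ j ∈ Finset.Icc 1 E.rank,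
      (C (C (E.kappa j)) * X ^ Fintype.card F ^ j : L[X][X]).coeff 1 = 0 :=
    fun j hj => by
      rw [coeff_C_mul_X_pow, if_neg]
      exact (Nat.one_lt_pow (Nat.one_le_iff_ne_zero.1 (Finset.mem_Icc.1 hj).1) Fintype.one_lt_card).ne
  rw [assocPoly, coeff_add, finsetSum_coeff, Finset.sum_eq_zero hq, add_zero, coeff_C_mul,
    coeff_X_one, mul_one]

theorem assocPoly_coeff_pow {j : ℕ} (hj : j ∈ Finset.Icc 1 E.rank) :
    E.assocPoly.coeff (Fintype.card F ^ j) = C (E.kappa j) := by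
  have h1 : 1 < Fintype.card F ^ j :=
    Nat.one_lt_pow (Nat.one_le_iff_ne_zero.1 (Finset.mem_Icc.1 hj).1) Fintype.one_lt_card
  rw [assocPoly, coeff_add, finsetSum_coeff, Finset.sum_eq_single j, coeff_C_mul, coeff_C_mul,
    coeff_X, if_neg h1.ne, coeff_X_pow_self, mul_zero, mul_one, zero_add]
  · intro i _ hij
    rw [coeff_C_mul_X_pow, if_neg]
    exact fun h => hij (card_pow_injective (F := F) h.symm)
  · exact fun h => absurd hj h

theorem natDegree_assocPoly : E.assocPoly.natDegree = Fintype.card F ^ E.rank := by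
  refine natDegree_eq_of_le_of_coeff_ne_zero ?_ ?_
  · have h1 : ∀ j, j ≤ E.rank → Fintype.card F ^ j ≤ Fintype.card F ^ E.rank := fun j hj =>
      Nat.pow_le_pow_right Fintype.card_pos hj
    refine natDegree_add_le_of_degree_le ?_ (natDegree_sum_le_of_forall_le _ _ fun j hj =>
      (natDegree_C_mul_X_pow_le _ _).trans (h1 j (Finset.mem_Icc.1 hj).2))
    refine (natDegree_C_mul_le _ _).trans (natDegree_X_le.trans ?_)
    simpa using h1 0 (Nat.zero_le _)
  · rw [E.assocPoly_coeff_pow (Finset.mem_Icc.2 ⟨E.rank_pos, le_rfl⟩), Ne, C_eq_zero]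
    exact E.kappa_rank_ne_zero

theorem newtonHeight_pow (v : Place L) {j : ℕ} (hj : j ∈ Finset.Icc 1 E.rank)
    (hκ : E.kappa j ≠ 0) :
    v.newtonHeight E.assocPoly (Fintype.card F ^ j) = v.val (E.kappa j) := by
  rw [Place.newtonHeight, E.assocPoly_coeff_pow hj, Place.ordPoly, support_C hκ]
  simp [Place.val]

/-- The coefficients of `t - θ` are `1` and `-θ`. The first bound serves to compare with `x`, the
second with the term `θ x` of `φ_t(x)`. -/
theorem newtonHeight_one_le (v : Place L) :
    v.newtonHeight E.assocPoly 1 ≤ 0 ∧ v.newtonHeight E.assocPoly 1 ≤ v.val (theta F L) := by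
  have h0 : theta F L ≠ 0 := theta_ne_zero
  have h : ∀ i, (X - C (theta F L) : L[X]).coeff i ≠ 0 →
      v.ordPoly (X - C (theta F L)) ≤ v.ord ((X - C (theta F L) : L[X]).coeff i) := fun i hi =>
    Finset.inf_le (mem_support_iff.2 hi)
  have h1 := h 1 (by simp)
  have h2 := h 0 (by simp [h0])
  have h3 : v.ordPoly (X - C (theta F L)) ≠ ⊤ := fun ht => by
    rw [ht] at h1
    simp at h1
  obtain ⟨n, hn⟩ := WithTop.ne_top_iff_exists.1 h3
  rw [Place.newtonHeight, E.assocPoly_coeff_one, ← hn]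
  rw [← hn] at h1 h2
  simp only [coeff_sub, coeff_X_one, coeff_X_zero, coeff_C_zero, zero_sub, AddValuation.map_neg] at h1 h2
  rw [coeff_C, if_neg one_ne_zero, sub_zero, AddValuation.map_one] at h1
  rw [← v.coe_val h0] at h2
  constructor
  · exact_mod_cast h1
  · exact_mod_cast h2

/-- The line through the right end point with the last slope lies below all points of the polygon;
the steeper slope `-m` puts it strictly below those further left. For `x` of order `m`, this makes
the top term of `φ_t(x)` dominate. -/
theorem val_kappa_add_lt (v : Place L) {m : ℤ} (hm : m < -⌈v.lastSlope E.assocPoly⌉) {i : ℕ}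
    (hi : i ∈ E.assocPoly.support) (hi' : i < Fintype.card F ^ E.rank) :
    v.val (E.kappa E.rank) + Fintype.card F ^ E.rank * m < v.newtonHeight E.assocPoly i + i * m := by
  have hne : (E.assocPoly.support.erase E.assocPoly.natDegree).Nonempty :=
    ⟨i, Finset.mem_erase.2 ⟨by rw [E.natDegree_assocPoly]; exact hi'.ne, hi⟩⟩
  have h := (v.lastSlope_spec E.assocPoly hne).1 i hi
  rw [E.natDegree_assocPoly, E.newtonHeight_pow v (Finset.mem_Icc.2 ⟨E.rank_pos, le_rfl⟩)
    E.kappa_rank_ne_zero] at h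
  have h1 := Int.le_ceil (v.lastSlope E.assocPoly)
  have h2 : (v.lastSlope E.assocPoly : ℚ) < -m := h1.trans_lt (by exact_mod_cast lt_neg.1 hm)
  have h3 : (0 : ℚ) < (Fintype.card F ^ E.rank : ℕ) - (i : ℚ) := sub_pos.2 (by exact_mod_cast hi')
  have h4 := mul_lt_mul_of_pos_right h2 h3
  have h5 : (v.val (E.kappa E.rank) : ℚ) + (Fintype.card F ^ E.rank : ℕ) * m
      < v.newtonHeight E.assocPoly i + i * m := by linarith
  exact_mod_cast h5

/-- Below the last slope of the Newton polygon, `φ_t` strictly decreases the order. -/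
theorem ord_act_X_lt (v : Place L) {x : L} (hx : x ≠ 0)
    (hm : v.val x < -⌈v.lastSlope E.assocPoly⌉) : v.ord (E.act X x) < v.ord x := by
  have hpow : ∀ n : ℕ, v.val (x ^ n) = n * v.val x := fun n => by
    rw [← zpow_natCast, v.val_zpow hx]
  have hterm : ∀ j, E.kappa j ≠ 0 → v.ord (E.kappa j * x ^ Fintype.card F ^ j)
      = ((v.val (E.kappa j) + Fintype.card F ^ j * v.val x : ℤ) : WithTop ℤ) := fun j hj => by
    rw [← v.coe_val (mul_ne_zero hj (pow_ne_zero _ hx)), v.val_mul hj (pow_ne_zero _ hx), hpow]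
    push_cast
    rfl
  have hone : (1 : ℕ) ∈ E.assocPoly.support := by
    rw [mem_support_iff, E.assocPoly_coeff_one]
    exact X_sub_C_ne_zero _
  -- Abscissa `1` is used twice: for the term `θ x`, and at the end for the comparison with `x`
  -- itself.
  have h1 := E.val_kappa_add_lt v hm hone
    (Nat.one_lt_pow E.rank_pos.ne' Fintype.one_lt_card)
  obtain ⟨hle0, hleθ⟩ := E.newtonHeight_one_le v
  have hrest : v.ord (E.kappa E.rank * x ^ Fintype.card F ^ E.rank)
      < v.ord (∑ i ∈ Finset.range E.rank, E.kappa i * x ^ Fintype.card F ^ i) := by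
    have hlead := hterm _ E.kappa_rank_ne_zero
    refine v.ord.map_lt_sum' (by rw [hlead]; exact WithTop.coe_lt_top _) fun i hi => ?_
    by_cases hκ : E.kappa i = 0
    · rw [hκ, zero_mul, v.ord.map_zero, hlead]
      exact WithTop.coe_lt_top _
    rw [hlead, hterm i hκ, WithTop.coe_lt_coe]
    rcases Nat.eq_zero_or_pos i with rfl | hpos
    · have : E.kappa 0 = theta F L := E.coeff_zero
      rw [this]
      push_cast at h1
      simp only [pow_zero]
      linarith
    · have hi' := Finset.mem_range.1 hi
      have hiI : i ∈ Finset.Icc 1 E.rank := Finset.mem_Icc.2 ⟨hpos, hi'.le⟩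
      have := E.val_kappa_add_lt v hm (i := Fintype.card F ^ i)
        (by rw [mem_support_iff, E.assocPoly_coeff_pow hiI, Ne, C_eq_zero]; exact hκ)
        (Nat.pow_lt_pow_right Fintype.one_lt_card hi')
      rw [E.newtonHeight_pow v hiI hκ] at this
      exact_mod_cast this
  rw [act_X, Finset.sum_range_succ, v.ord.map_add_eq_of_lt_right hrest,
    hterm _ E.kappa_rank_ne_zero, ← v.coe_val hx, WithTop.coe_lt_coe]
  push_cast at h1
  linarith

end

end DrinfeldModule

theorem coeff_divX_iterate {R : Type*} [Semiring R] (p : R[X]) (j n : ℕ) :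
    (divX^[j] p).coeff n = p.coeff (n + j) := by
  induction j generalizing n with
  | zero => rfl
  | succ j ih => rw [Function.iterate_succ_apply', coeff_divX, ih, add_assoc, add_comm 1 j]

theorem vecDiv_le_ord {F L : Type*} [Field F] [Finite F] [Field L] [Algebra F L]
    [Algebra (RatFunc F) L] [IsScalarTower F (RatFunc F) L] [FiniteDimensional (RatFunc F) L]
    {n : ℕ} {x : Fin n → L} (hx : ∀ i, x i ≠ 0) (v : Place L) (i : Fin n) :
    ((vecDiv F x v : ℤ) : WithTop ℤ) ≤ v.ord (x i) := by
  have h : v.ordVec x ≤ v.ord (x i) := Finset.inf_le (Finset.mem_univ i)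
  have hne : v.ordVec x ≠ ⊤ := fun ht => by
    rw [ht, ← v.coe_val (hx i)] at h
    exact WithTop.coe_ne_top (top_le_iff.1 h)
  obtain ⟨k, hk⟩ := WithTop.ne_top_iff_exists.1 hne
  have : vecDiv F x v = k := by
    change (v.ordVec x).untopD 0 = k
    rw [← hk]
    rfl
  rw [this, hk]
  exact h

/-! ### Truncations of a relation -/

namespace DrinfeldModule

variable {F L : Type*} [Field F] [Fintype F] [Field L] [Algebra F L] [Algebra (RatFunc F) L]
  (E : DrinfeldModule F L)

theorem act_C (c : F) (x : L) : E.act (C c) x = c • x := by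
  have h : E.φ (C c) = algebraMap F _ c := E.φ.commutes c
  rw [act, h, AlgHom.commutes]
  simp

theorem act_X_pow (j : ℕ) (x : L) :
    E.act (X ^ j) x = ((TwistedPolynomial.eval (E.φ X)) ^ j) x := by
  rw [act, map_pow, map_pow]

theorem act_eq_act_divX (p : F[X]) (x : L) :
    E.act p x = E.act X (E.act p.divX x) + p.coeff 0 • x := by
  conv_lhs => rw [← X_mul_divX_add p]
  rw [act_add, act_mul, act_C]

theorem act_sum {ι : Type*} (s : Finset ι) (p : ι → F[X]) (x : L) :
    E.act (∑ j ∈ s, p j) x = ∑ j ∈ s, E.act (p j) x := by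
  simp [act]

/-- The value at `x` of the `j`-th truncation `∑ a_n t ^ (n - j)` of the relation `a`. -/
def truncatedSum {n : ℕ} (a : Fin n → F[X]) (x : Fin n → L) (j : ℕ) : L :=
  ∑ i, E.act (divX^[j] (a i)) (x i)

/-- One step of Horner's scheme: `p = t · (p div t) + p(0)`, applied to each truncated coefficient.
-/
theorem truncatedSum_eq {n : ℕ} (a : Fin n → F[X]) (x : Fin n → L) (j : ℕ) :
    E.truncatedSum a x j = TwistedPolynomial.eval (E.φ X) (E.truncatedSum a x (j + 1))
      + Fintype.linearCombination F x (fun i => (a i).coeff j) := by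
  rw [truncatedSum, truncatedSum, map_sum, Fintype.linearCombination_apply,
    ← Finset.sum_add_distrib]
  refine Finset.sum_congr rfl fun i _ => ?_
  rw [act_eq_act_divX, coeff_divX_iterate, zero_add, ← Function.iterate_succ_apply' divX]
  rfl

theorem truncatedSum_eq_zero {n : ℕ} {a : Fin n → F[X]} (x : Fin n → L) {m j : ℕ}
    (hm : ∀ i, (a i).natDegree ≤ m) (hj : m < j) : E.truncatedSum a x j = 0 := by
  refine Finset.sum_eq_zero fun i _ => ?_
  have : divX^[j] (a i) = 0 := Polynomial.ext fun k => by
    rw [coeff_divX_iterate, Polynomial.coeff_zero]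
    exact coeff_eq_zero_of_natDegree_lt ((hm i).trans_lt (hj.trans_le (Nat.le_add_left _ _)))
  simp [this, act]

variable [IsScalarTower F (RatFunc F) L] [FiniteDimensional (RatFunc F) L]

/-- At each place it suffices to bound a truncation of least order. Were it below `-D(v)`, `φ_t`
would lower its order strictly, whereas the recursion writes the image as a difference of two
elements of at least that order. -/
theorem truncatedSum_mem_riemannRoch {n : ℕ} {a : Fin n → F[X]} {x : Fin n → L}
    (hx : ∀ i, x i ≠ 0) (h0 : ∑ i, E.act (a i) (x i) = 0) (j : ℕ) :
    E.truncatedSum a x j ∈ riemannRoch F (-vecDiv F x ⊔ E.slopeDivisor) := by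
  intro v
  set D := -vecDiv F x ⊔ E.slopeDivisor
  have hD1 : -D v ≤ vecDiv F x v := by
    have : -vecDiv F x v ≤ D v := le_sup_left
    omega
  have hD2 : -D v ≤ -⌈v.lastSlope E.assocPoly⌉ := by
    have : ⌈v.lastSlope E.assocPoly⌉ ≤ D v := le_sup_right
    omega
  set g := E.truncatedSum a x
  let m := Finset.univ.sup fun i => (a i).natDegree
  have hbig : ∀ j, m < j → g j = 0 := fun j hj =>
    E.truncatedSum_eq_zero x (fun i => Finset.le_sup (f := fun i => (a i).natDegree)
      (Finset.mem_univ i)) hj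
  -- Truncations beyond the degree `m` vanish, so a minimum over finitely many indices is a global
  -- one.
  obtain ⟨k, hk, hmin⟩ := Finset.exists_min_image (Finset.range (m + 1)) (fun j => v.ord (g j))
    ⟨0, by simp⟩
  have hmin' : ∀ j, v.ord (g k) ≤ v.ord (g j) := fun j => by
    rcases lt_or_ge m j with h | h
    · rw [hbig j h, v.ord.map_zero]
      exact le_top
    · exact hmin j (Finset.mem_range.2 (Nat.lt_succ_of_le h))
  refine le_trans ?_ (hmin' j)
  by_contra! hlt
  have hk0 : g k ≠ 0 := fun h => by
    rw [h, v.ord.map_zero] at hlt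
    exact not_top_lt hlt
  -- The minimum is not at index `0`, since `g 0` is the given relation and vanishes; so `k` has a
  -- predecessor.
  obtain ⟨i, rfl⟩ : ∃ i, k = i + 1 := Nat.exists_eq_succ_of_ne_zero (by
    rintro rfl
    exact hk0 h0)
  have hval : v.val (g (i + 1)) < -D v := by
    rw [← v.coe_val hk0] at hlt
    exact_mod_cast hlt
  have h1 := E.ord_act_X_lt v hk0 (hval.trans_le hD2)
  have h2 : v.ord (g (i + 1)) ≤ v.ord (Fintype.linearCombination F x fun s => (a s).coeff i) := by
    rw [Fintype.linearCombination_apply]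
    refine v.ord.map_le_sum fun s _ => ?_
    rw [Algebra.smul_def, v.ord.map_mul]
    refine le_trans ?_ (le_add_of_nonneg_left (v.ord_algebraMap_nonneg _))
    exact hlt.le.trans ((WithTop.coe_le_coe.2 hD1).trans (vecDiv_le_ord hx v s))
  have h3 : E.act X (g (i + 1))
      = g i - Fintype.linearCombination F x fun s => (a s).coeff i :=
    eq_sub_of_add_eq (E.truncatedSum_eq a x i).symm
  rw [h3] at h1
  exact absurd h1 (not_lt.2 (v.ord.map_le_sub (hmin' i) h2))

end DrinfeldModule

end Drinfeld

end

/-! ### The degree bound for linear independence -/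

theorem corollary1p3 {F L : Type*} [Field F] [Fintype F] [Field L] [Algebra F L]
    [Algebra (RatFunc F) L] [IsScalarTower F (RatFunc F) L] [FiniteDimensional (RatFunc F) L]
    (E : Drinfeld.DrinfeldModule F L) {l : ℕ} (P : Fin l → L) (hP : ∀ i, P i ≠ 0)
    (hinj : Function.Injective P) (D : Drinfeld.Place L →₀ ℤ)
    (hD : D = (-Drinfeld.vecDiv F P) ⊔ E.slopeDivisor) :
    FiniteDimensional F (Drinfeld.riemannRoch F D) ∧
    ((∀ a : Fin l → F[X], a ≠ 0 →
        (∀ i, (a i).natDegree ≤ Module.finrank F (Drinfeld.riemannRoch F D) + l) →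
        ∑ i, E.act (a i) (P i) ≠ 0) →
      LinearIndependent F[X] fun i => E.point (P i)) := by
  have hfin := Drinfeld.finiteDimensional_riemannRoch F D
  refine ⟨hfin, fun h => ?_⟩
  rw [Fintype.linearIndependent_iff]
  intro a ha
  have ha : ∑ i, E.act (a i) (P i) = 0 := by
    simp only [E.smul_point, ← map_sum] at ha
    exact E.point.map_eq_zero_iff.1 ha
  by_contra! hne
  obtain ⟨i₁, hi₁⟩ := hne
  classical
  -- A coefficient of maximal degree `m`: its leading coefficient makes the vector of coefficients
  -- of `t ^ m` nonzero.
  obtain ⟨i₀, hi₀, hmax⟩ := Finset.exists_max_image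
    (Finset.univ.filter fun i => a i ≠ 0) (fun i => (a i).natDegree) ⟨i₁, by simpa using hi₁⟩
  replace hi₀ : a i₀ ≠ 0 := (Finset.mem_filter.1 hi₀).2
  have hdeg : ∀ i, (a i).natDegree ≤ (a i₀).natDegree := fun i => by
    by_cases hi : a i = 0
    · simp [hi]
    · exact hmax i (by simpa using hi)
  obtain ⟨u, hu, hsum⟩ := Drinfeld.exists_short_relation (Drinfeld.riemannRoch F D)
    (Drinfeld.TwistedPolynomial.eval (E.φ X)) (Fintype.linearCombination F P)
    (E.truncatedSum_eq a P)
    (fun j => by rw [hD]; exact E.truncatedSum_mem_riemannRoch hP ha j) ha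
    (E.truncatedSum_eq_zero P hdeg (Nat.lt_succ_self _))
  set d := Module.finrank F (Drinfeld.riemannRoch F D)
  -- The short relation, read as polynomials in `t`, has degree at most `d`, which is within the
  -- bound `d + l`.
  refine h (fun i => ∑ j ∈ Finset.range (d + 1), X ^ j * C (u j i)) (fun h0 => ?_) (fun i => ?_) ?_
  · have h1 := congrArg (fun p => coeff p d) (congrFun h0 i₀)
    have h2 : u d i₀ = 0 := by
      simpa [finsetSum_coeff, coeff_mul_C, coeff_X_pow] using h1
    rw [hu] at h2
    exact hi₀ (leadingCoeff_eq_zero.1 h2)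
  · refine (natDegree_sum_le_of_forall_le (n := d) _ _ fun j hj => ?_).trans (Nat.le_add_right d l)
    exact (natDegree_mul_C_le _ _).trans ((natDegree_X_pow_le j).trans
      (Nat.le_of_lt_succ (Finset.mem_range.1 hj)))
  · simp only [E.act_sum]
    rw [Finset.sum_comm, ← hsum]
    refine Finset.sum_congr rfl fun j _ => ?_
    rw [Fintype.linearCombination_apply, map_sum]
    refine Finset.sum_congr rfl fun i _ => ?_
    rw [E.act_mul, E.act_C, E.act_X_pow]
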